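/- All graphs are finite, simple and undirected. For a graph $G$ and $S\subseteq V(G)$ with $|S|\ge 2$, an $S$-tree is a subgraph $T$ of $G$ that is a tree with $S\subseteq V(T)$. Two $S$-trees $T,T'$ are internally disjoint if $E(T)\cap E(T')=\varnothing$ and $V(T)\cap V(T')=S$. Let $\kappa_G(S)$ be the maximum number of pairwise internally disjoint $S$-trees in $G$, and let $\overline{\kappa}_3(G)=\max\{\kappa_G(S) : S\subseteq V(G),\ |S|=3\}$. For $n\ge 3$ let $h(n;\overline{\kappa}_3\ge 3)$ be the smallest non-negative integer $m$ such that every graph $G$ with $n$ vertices and exactly $m$ edges satisfies $\overline{\kappa}_3(G)\ge 3$, i.e. contains a set $S$ of three vertices with three pairwise internally disjoint $S$-trees (the condition holds vacuously if no graph with $n$ vertices has $m$ edges). Then, for every integer $n\ge 3$, $$h(n;\overline{\kappa}_3\ge 3)=\begin{cases}2n-1 & \text{if } n=4,\\ 2n-2 & \text{if } n\ge 3,\ n\ne 4.\end{cases}$$ -/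

import Mathlib

namespace SteinerConn

variable {V : Type*}

/-- An `S`-Steiner tree (`S`-tree) of `G`: a subgraph of `G` that is a tree and contains `S`. -/
def IsSteinerTree (G : SimpleGraph V) (S : Set V) (T : G.Subgraph) : Prop :=
  S ⊆ T.verts ∧ T.coe.IsTree

/-- Two `S`-trees are internally disjoint if they share no edge and share exactly
the vertices of `S`. -/
def InternallyDisjoint {G : SimpleGraph V} (S : Set V) (T T' : G.Subgraph) : Prop :=
  T.edgeSet ∩ T'.edgeSet = ∅ ∧ T.verts ∩ T'.verts = S

/-- `F` is a (finite) set of pairwise internally disjoint `S`-trees of `G`. -/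
def IsSteinerPacking (G : SimpleGraph V) (S : Set V) (F : Finset G.Subgraph) : Prop :=
  (∀ T ∈ F, IsSteinerTree G S T) ∧
    ∀ T ∈ F, ∀ T' ∈ F, T ≠ T' → InternallyDisjoint S T T'

/-- The generalized local connectivity `κ_G(S)`: the maximum number of (pairwise)
internally disjoint `S`-trees in `G`. -/
noncomputable def localConn (G : SimpleGraph V) (S : Set V) : ℕ :=
  sSup {m : ℕ | ∃ F : Finset G.Subgraph, IsSteinerPacking G S F ∧ F.card = m}

/-- In a finite graph the maximum in the definition of `localConn` is attained. -/
theorem localConn_isGreatest [Finite V] (G : SimpleGraph V) (S : Set V) :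
    IsGreatest {m : ℕ | ∃ F : Finset G.Subgraph, IsSteinerPacking G S F ∧ F.card = m}
      (localConn G S) := by
  have hb : BddAbove {m : ℕ | ∃ F : Finset G.Subgraph, IsSteinerPacking G S F ∧ F.card = m} := by
    have : Fintype G.Subgraph := Fintype.ofFinite _
    refine ⟨Fintype.card G.Subgraph, ?_⟩
    rintro m ⟨F, -, rfl⟩
    exact F.card_le_univ
  have hn : {m : ℕ | ∃ F : Finset G.Subgraph, IsSteinerPacking G S F ∧ F.card = m}.Nonempty :=
    ⟨0, ∅, ⟨by simp, by simp⟩, rfl⟩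
  exact ⟨Nat.sSup_mem hn hb, fun m hm => le_csSup hb hm⟩

/-- The maximum generalized local connectivity of a finite graph:
the maximum of `κ_G(S)` over all `k`-element vertex sets `S`. -/
noncomputable def maxLocalConn [Fintype V] (k : ℕ) (G : SimpleGraph V) : ℕ :=
  (Finset.powersetCard k (Finset.univ : Finset V)).sup fun S => localConn G (S : Set V)

/-- The numbers `m` such that every graph with `n` vertices and `m` edges has maximum
generalized local connectivity (for `k`-sets) at least `r`. -/
def forcingSizes (n k r : ℕ) : Set ℕ :=
  {m : ℕ | ∀ G : SimpleGraph (Fin n), G.edgeSet.ncard = m → r ≤ maxLocalConn k G}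

/-- The smallest number of edges that forces, in a graph with `n` vertices,
maximum generalized local connectivity (for `k`-sets) at least `r`. -/
noncomputable def h (n k r : ℕ) : ℕ :=
  sInf (forcingSizes n k r)

/-- The minimum in the definition of `h` is attained. -/
theorem h_isLeast (n k r : ℕ) : IsLeast (forcingSizes n k r) (h n k r) := by
  refine ⟨Nat.sInf_mem ⟨Nat.card (Sym2 (Fin n)) + 1, fun G hG => ?_⟩, fun m hm => Nat.sInf_le hm⟩
  have := Set.ncard_le_card G.edgeSet
  omega

end SteinerConn

/-!
The value of `h n 3 3` amounts to two facts about a graph `G` with `n ≥ 3` vertices.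

*Upper bound.* If `G` has at least `2 n - 2` edges and is not `K₄`, it contains three internally
disjoint `S`-trees for some triple `S` (`hasThree_or_isNClique_four`). Instead of trees, connected
subgraphs are used throughout (`HasThree`); spanning trees are taken only at the very end. The
proof is by induction on the number of vertices. Deleting edges, `G` has exactly `2 n - 2` edges,
so some vertex `v` has degree at most `3`. If its degree is at most `2`, delete it. If it is `3` and
two neighbours of `v` are not adjacent, delete `v` and join these two neighbours; trees of the new
graph give trees of `G` (`HasThree.of_suppress`). If the smaller graph is an exceptional `K₄`, the
configuration is found directly. What remains is that `v` and its neighbours form a `K₄`.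

So let `G` contain a `K₄` with vertices `x, y, z, v`, and have at least five vertices. If a component
outside the `K₄` is attached to both `x` and `y`, then `S = {x, y, z}` works, with the star at `v`,
the path `y x z`, and the path from `x` through the component to `y` and on to `z`
(`hasThree_of_clique_of_attached`). Otherwise the component is attached to at most one vertex of
the `K₄`, which separates it from the rest. Since the function `2 n - 2` is additive when graphs are
glued at one vertex, one of the two parts still has enough edges, and the induction applies unless
that part is another `K₄`; two copies of `K₄` sharing a vertex contain the desired trees
(`hasThree_of_two_cliques`).

*Lower bound.* An edge joined completely to `n - 2` isolated vertices has `2 n - 3` edges. Every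
triple contains a vertex of degree `2`, and internally disjoint trees use different edges there, so
there are at most two of them; the same holds for all subgraphs. For `n = 4` even `K₄` does not
suffice (`maxLocalConn_lt_of_card_eq_four`), and no graph on four vertices has
`7` edges.
-/

namespace SteinerConn

open SimpleGraph

variable {V : Type*}

/-! ### Three connected pieces meeting in a triple -/

/-- `T` has all its edges inside `W` and connects any two vertices of `W`; that is, `W` and the
edges of `T` form a connected graph. -/
def Spans (T : SimpleGraph V) (W : Set V) : Prop :=
  T.support ⊆ W ∧ ∀ a ∈ W, ∀ b ∈ W, T.Reachable a b

/-- `G` contains three pairwise edge-disjoint connected subgraphs, with edge sets given by `T i`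
and vertex sets `W i`, any two of which share exactly the vertices of a common triple `S`.
Connected graphs in place of trees make no difference, as spanning trees may be taken. -/
def HasThree (G : SimpleGraph V) : Prop :=
  ∃ (S : Finset V) (T : Fin 3 → SimpleGraph V) (W : Fin 3 → Set V), S.card = 3 ∧
    (∀ i, T i ≤ G ∧ Spans (T i) (W i) ∧ ↑S ⊆ W i) ∧
    ∀ i j, i ≠ j → (∀ u w, (T i).Adj u w → ¬ (T j).Adj u w) ∧ W i ∩ W j ⊆ S

theorem HasThree.mono {G H : SimpleGraph V} (hGH : G ≤ H) (hG : HasThree G) : HasThree H := by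
  obtain ⟨S, T, W, hS, hT, hd⟩ := hG
  exact ⟨S, T, W, hS, fun i => ⟨(hT i).1.trans hGH, (hT i).2⟩, hd⟩

theorem HasThree.intro {G : SimpleGraph V} (S : Finset V) (T₁ T₂ T₃ : SimpleGraph V)
    (W₁ W₂ W₃ : Set V) (hS : S.card = 3) (hG₁ : T₁ ≤ G) (hG₂ : T₂ ≤ G) (hG₃ : T₃ ≤ G)
    (h₁ : Spans T₁ W₁) (h₂ : Spans T₂ W₂) (h₃ : Spans T₃ W₃)
    (hS₁ : ↑S ⊆ W₁) (hS₂ : ↑S ⊆ W₂) (hS₃ : ↑S ⊆ W₃)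
    (h₁₂ : ∀ u w, T₁.Adj u w → ¬ T₂.Adj u w) (h₁₃ : ∀ u w, T₁.Adj u w → ¬ T₃.Adj u w)
    (h₂₃ : ∀ u w, T₂.Adj u w → ¬ T₃.Adj u w)
    (hW₁₂ : W₁ ∩ W₂ ⊆ S) (hW₁₃ : W₁ ∩ W₃ ⊆ S) (hW₂₃ : W₂ ∩ W₃ ⊆ S) : HasThree G := by
  refine ⟨S, ![T₁, T₂, T₃], ![W₁, W₂, W₃], hS, ?_, ?_⟩
  · intro i
    fin_cases i
    exacts [⟨hG₁, h₁, hS₁⟩, ⟨hG₂, h₂, hS₂⟩, ⟨hG₃, h₃, hS₃⟩]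
  · intro i j hij
    fin_cases i <;> fin_cases j
    exacts [(hij rfl).elim, ⟨h₁₂, hW₁₂⟩, ⟨h₁₃, hW₁₃⟩,
      ⟨fun u w h h' => h₁₂ u w h' h, Set.inter_comm W₁ W₂ ▸ hW₁₂⟩, (hij rfl).elim, ⟨h₂₃, hW₂₃⟩,
      ⟨fun u w h h' => h₁₃ u w h' h, Set.inter_comm W₁ W₃ ▸ hW₁₃⟩,
      ⟨fun u w h h' => h₂₃ u w h' h, Set.inter_comm W₂ W₃ ▸ hW₂₃⟩, (hij rfl).elim]

theorem Spans.sup {T T' : SimpleGraph V} {W W' : Set V} (h : Spans T W) (h' : Spans T' W')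
    (hne : (W ∩ W').Nonempty) : Spans (T ⊔ T') (W ∪ W') := by
  obtain ⟨r, hr, hr'⟩ := hne
  have key : ∀ a ∈ W ∪ W', (T ⊔ T').Reachable a r := by
    rintro a (ha | ha)
    · exact (h.2 a ha r hr).mono le_sup_left
    · exact (h'.2 a ha r hr').mono le_sup_right
  refine ⟨?_, fun a ha b hb => (key a ha).trans (key b hb).symm⟩
  rintro a ⟨b, hab | hab⟩
  · exact Or.inl (h.1 ⟨b, hab⟩)
  · exact Or.inr (h'.1 ⟨b, hab⟩)

/-- The star with centre `c` and set of leaves `s`. -/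
def star (c : V) (s : Set V) : SimpleGraph V where
  Adj u w := u ≠ w ∧ (u = c ∧ w ∈ s ∨ w = c ∧ u ∈ s)
  symm := ⟨fun _ _ h => ⟨h.1.symm, h.2.symm⟩⟩
  loopless := ⟨fun _ h => h.1 rfl⟩

theorem star_adj {c : V} {s : Set V} {u w : V} :
    (star c s).Adj u w ↔ u ≠ w ∧ (u = c ∧ w ∈ s ∨ w = c ∧ u ∈ s) := Iff.rfl

theorem star_le {G : SimpleGraph V} {c : V} {s : Set V} (h : ∀ a ∈ s, G.Adj c a) :
    star c s ≤ G := by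
  rintro u w ⟨-, ⟨rfl, hw⟩ | ⟨rfl, hu⟩⟩
  · exact h _ hw
  · exact (h _ hu).symm

theorem spans_star (c : V) (s : Set V) : Spans (star c s) (insert c s) := by
  have key : ∀ a ∈ insert c s, (star c s).Reachable a c := by
    rintro a (rfl | ha)
    · rfl
    · by_cases hac : a = c
      · rw [hac]
      · exact Adj.reachable ⟨hac, Or.inr ⟨rfl, ha⟩⟩
  refine ⟨?_, fun a ha b hb => (key a ha).trans (key b hb).symm⟩
  rintro a ⟨b, -, ⟨rfl, -⟩ | ⟨-, ha⟩⟩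
  · exact Set.mem_insert _ _
  · exact Set.mem_insert_of_mem _ ha

/-! ### Configurations with three internally disjoint trees -/

/-- A `K₄` on `x, y, z, v` together with a connected subgraph attached to `x` and `y` and otherwise
disjoint from the `K₄`: the star at `v`, the path `y x z`, and the path from `x` through the
attached subgraph to `y` and on to `z`. -/
theorem hasThree_of_clique_of_attached {G : SimpleGraph V} {x y z v : V}
    (hxy : G.Adj x y) (hxz : G.Adj x z) (hxv : G.Adj x v) (hyz : G.Adj y z) (hyv : G.Adj y v)
    (hzv : G.Adj z v) {T : SimpleGraph V} {C : Set V} (hT : T ≤ G) (hTC : Spans T C)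
    (hx : x ∉ C) (hy : y ∉ C) (hz : z ∉ C) (hv : v ∉ C) {a b : V} (ha : a ∈ C) (hb : b ∈ C)
    (hxa : G.Adj x a) (hyb : G.Adj y b) : HasThree G := by
  classical
  have hTa : ∀ {u w}, T.Adj u w → u ∈ C ∧ w ∈ C := fun h => ⟨hTC.1 ⟨_, h⟩, hTC.1 ⟨_, h.symm⟩⟩
  have n1 := hxy.ne
  have n2 := hxz.ne
  have n3 := hxv.ne
  have n4 := hyz.ne
  have n5 := hyv.ne
  have n6 := hzv.ne
  refine HasThree.intro {x, y, z} (star v {x, y, z}) (star x {y, z})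
    (T ⊔ star x {a} ⊔ star y {b, z}) _ _ _ ?_ (star_le ?_) (star_le ?_)
    (sup_le (sup_le hT (star_le ?_)) (star_le ?_)) (spans_star _ _) (spans_star _ _)
    ((hTC.sup (spans_star _ _) ⟨a, ha, by simp⟩).sup (spans_star _ _) ⟨b, by simp [hb], by simp⟩)
    ?_ ?_ ?_ ?_ ?_ ?_ ?_ ?_ ?_
  · exact Finset.card_eq_three.2 ⟨x, y, z, n1, n2, n4, rfl⟩
  · simp [hxv.symm, hyv.symm, hzv.symm]
  · simp [hxy, hxz]
  · simp [hxa]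
  · simp [hyb, hyz]
  · intro u; simp; grind
  · intro u; simp
  · intro u; simp; grind
  · intro u w; simp only [star_adj, Set.mem_insert_iff, Set.mem_singleton_iff]; grind
  · intro u w; simp only [sup_adj, star_adj, Set.mem_insert_iff, Set.mem_singleton_iff]; grind
  · intro u w; simp only [sup_adj, star_adj, Set.mem_insert_iff, Set.mem_singleton_iff]; grind
  · intro u; simp
  · intro u; simp; grind
  · intro u; simp; grind

/-- Two copies of `K₄` on `x, a, b, c` and `x, p, q, r` sharing only the vertex `x`: each of them
contains three internally disjoint paths ending in `x`, and these can be concatenated. -/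
theorem hasThree_of_two_cliques {G : SimpleGraph V} {x a b c p q r : V}
    (hxa : G.Adj x a) (hxb : G.Adj x b) (hxc : G.Adj x c) (hab : G.Adj a b) (hac : G.Adj a c)
    (hbc : b ≠ c) (hxp : G.Adj x p) (hxq : G.Adj x q) (hxr : G.Adj x r) (hpq : G.Adj p q)
    (hpr : G.Adj p r) (hqr : q ≠ r)
    (hdisj : ∀ u, (u = a ∨ u = b ∨ u = c) → ¬ (u = p ∨ u = q ∨ u = r)) : HasThree G := by
  classical
  have n1 := hxa.ne
  have n2 := hxb.ne
  have n3 := hxc.ne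
  have n4 := hab.ne
  have n5 := hac.ne
  have m1 := hxp.ne
  have m2 := hxq.ne
  have m3 := hxr.ne
  have m4 := hpq.ne
  have m5 := hpr.ne
  have d1 := hdisj a (by simp)
  have d2 := hdisj b (by simp)
  have d3 := hdisj c (by simp)
  clear hdisj
  simp only [not_or] at d1 d2 d3
  refine HasThree.intro {x, a, p} (star x {a, p}) (star b {a, x} ⊔ star q {x, p})
    (star c {a, x} ⊔ star r {x, p}) _ _ _ ?_ (star_le ?_)
    (sup_le (star_le ?_) (star_le ?_)) (sup_le (star_le ?_) (star_le ?_)) (spans_star _ _)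
    ((spans_star _ _).sup (spans_star _ _) ⟨x, by simp, by simp⟩)
    ((spans_star _ _).sup (spans_star _ _) ⟨x, by simp, by simp⟩)
    ?_ ?_ ?_ ?_ ?_ ?_ ?_ ?_ ?_
  · exact Finset.card_eq_three.2 ⟨x, a, p, n1, m1, d1.1, rfl⟩
  · simp [hxa, hxp]
  · simp [hxb.symm, hab.symm]
  · simp [hxq.symm, hpq.symm]
  · simp [hxc.symm, hac.symm]
  · simp [hxr.symm, hpr.symm]
  · intro u; simp
  · intro u; simp; grind
  · intro u; simp; grind
  · intro u w; simp only [sup_adj, star_adj, Set.mem_insert_iff, Set.mem_singleton_iff]; grind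
  · intro u w; simp only [sup_adj, star_adj, Set.mem_insert_iff, Set.mem_singleton_iff]; grind
  · intro u w; simp only [sup_adj, star_adj, Set.mem_insert_iff, Set.mem_singleton_iff]; grind
  · intro u; simp; grind
  · intro u; simp; grind
  · intro u; simp; grind

/-- Two vertices `u, v` adjacent to all of `x, y, z`, and the path `x z y`. -/
theorem hasThree_of_two_stars {G : SimpleGraph V} {x y z u v : V}
    (hux : G.Adj u x) (huy : G.Adj u y) (huz : G.Adj u z)
    (hvx : G.Adj v x) (hvy : G.Adj v y) (hvz : G.Adj v z) (hxz : G.Adj x z) (hyz : G.Adj y z)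
    (hxy : x ≠ y) (huv : u ≠ v) : HasThree G := by
  classical
  have n1 := hux.ne
  have n2 := huy.ne
  have n3 := huz.ne
  have m1 := hvx.ne
  have m2 := hvy.ne
  have m3 := hvz.ne
  refine HasThree.intro {x, y, z} (star u {x, y, z}) (star v {x, y, z}) (star z {x, y}) _ _ _ ?_
    (star_le ?_) (star_le ?_) (star_le ?_) (spans_star _ _) (spans_star _ _) (spans_star _ _)
    ?_ ?_ ?_ ?_ ?_ ?_ ?_ ?_ ?_
  · exact Finset.card_eq_three.2 ⟨x, y, z, hxy, hxz.ne, hyz.ne, rfl⟩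
  · simp [hux, huy, huz]
  · simp [hvx, hvy, hvz]
  · simp [hxz.symm, hyz.symm]
  · intro u; simp; grind
  · intro u; simp; grind
  · intro u; simp; grind
  · intro u w; simp only [star_adj, Set.mem_insert_iff, Set.mem_singleton_iff]; grind
  · intro u w; simp only [star_adj, Set.mem_insert_iff, Set.mem_singleton_iff]; grind
  · intro u w; simp only [star_adj, Set.mem_insert_iff, Set.mem_singleton_iff]; grind
  · intro u; simp; grind
  · intro u; simp; grind
  · intro u; simp; grind

/-! ### Suppressing a vertex -/

theorem exists_adj_of_reachable_of_ne {T : SimpleGraph V} {a b : V} (h : T.Reachable a b)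
    (hab : a ≠ b) : ∃ c, T.Adj a c := by
  obtain ⟨p⟩ := h
  cases p with
  | nil => exact (hab rfl).elim
  | cons h _ => exact ⟨_, h⟩

/-- A spanned set with three distinguished vertices has no vertex isolated in `T`. -/
theorem Spans.exists_adj {T : SimpleGraph V} {W : Set V} (h : Spans T W) {S : Finset V}
    (hS : S.card = 3) (hSW : ↑S ⊆ W) {v : V} (hv : v ∈ W) : ∃ c, T.Adj v c := by
  obtain ⟨s, hs, hsv⟩ := Finset.exists_mem_ne (by omega : 1 < S.card) v
  exact exists_adj_of_reachable_of_ne (h.2 v hv s (hSW hs)) hsv.symm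

/-- If a graph obtained from `G` by deleting `v` and joining two neighbours of `v` by an edge
contains three internally disjoint trees, so does `G`: the new edge is used by at most one of
the trees, where it can be replaced by the path through `v`. -/
theorem HasThree.of_suppress {G : SimpleGraph V} {v x y : V} (hvx : G.Adj v x) (hvy : G.Adj v y)
    (h : HasThree (G.deleteIncidenceSet v ⊔ edge x y)) : HasThree G := by
  obtain ⟨S, T, W, hS, hT, hd⟩ := h
  have nx := hvx.ne
  have ny := hvy.ne
  have hadj : ∀ i a b, (T i).Adj a b → a ≠ v ∧ b ≠ v ∧
      (G.Adj a b ∨ (a = x ∧ b = y ∨ a = y ∧ b = x)) := by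
    intro i a b hab
    rcases (hT i).1 hab with hab | hab
    · rw [deleteIncidenceSet_adj] at hab
      exact ⟨hab.2.1, hab.2.2, Or.inl hab.1⟩
    · rw [edge_adj] at hab
      grind
  have hvW : ∀ i, v ∉ W i := by
    intro i hv
    obtain ⟨c, hc⟩ := (hT i).2.1.exists_adj hS (hT i).2.2 hv
    exact (hadj i v c hc).1 rfl
  let R : Fin 3 → SimpleGraph V := fun i =>
    { Adj := fun a b => ((T i).Adj a b ∧ s(a, b) ≠ s(x, y)) ∨
        ((T i).Adj x y ∧ (star v {x, y}).Adj a b)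
      symm := ⟨fun a b h => by
        rcases h with h | h
        · exact Or.inl ⟨h.1.symm, by rw [Sym2.eq_swap]; exact h.2⟩
        · exact Or.inr ⟨h.1, h.2.symm⟩⟩
      loopless := ⟨fun a h => by
        rcases h with h | h
        · exact h.1.ne rfl
        · exact h.2.ne rfl⟩ }
  have hR : ∀ i a b, (R i).Adj a b ↔ ((T i).Adj a b ∧ s(a, b) ≠ s(x, y)) ∨
        ((T i).Adj x y ∧ (star v {x, y}).Adj a b) := fun i a b => Iff.rfl
  have hvR : ∀ i, (T i).Adj x y → (R i).Adj v x ∧ (R i).Adj v y := by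
    intro i hi
    simp only [hR, star_adj, Set.mem_insert_iff, Set.mem_singleton_iff]
    grind
  have hstep : ∀ i a b, (T i).Adj a b → (R i).Reachable a b := by
    intro i a b hab
    by_cases he : s(a, b) = s(x, y)
    · have hxy : (T i).Adj x y := by rwa [← mem_edgeSet, ← he]
      have hp : (R i).Reachable x y :=
        (hvR i hxy).1.symm.reachable.trans (hvR i hxy).2.reachable
      rcases Sym2.eq_iff.1 he with ⟨rfl, rfl⟩ | ⟨rfl, rfl⟩
      exacts [hp, hp.symm]
    · exact Adj.reachable (Or.inl ⟨hab, he⟩)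
  have hreach : ∀ i a b, (T i).Reachable a b → (R i).Reachable a b := by
    rintro i a b ⟨p⟩
    induction p with
    | nil => rfl
    | cons h _ ih => exact (hstep i _ _ h).trans ih
  have hxyW : ∀ i, (T i).Adj x y → x ∈ W i ∧ y ∈ W i := fun i hi =>
    ⟨(hT i).2.1.1 ⟨_, hi⟩, (hT i).2.1.1 ⟨_, hi.symm⟩⟩
  refine ⟨S, R, fun i => W i ∪ {u | u = v ∧ (T i).Adj x y}, hS, fun i => ⟨?_, ⟨?_, ?_⟩, ?_⟩, ?_⟩
  · intro a b hab
    rcases hab with ⟨hab, hne⟩ | ⟨-, hab⟩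
    · have := hadj i a b hab
      simp only [ne_eq, Sym2.eq_iff] at hne
      tauto
    · refine star_le ?_ hab
      simp [hvx, hvy]
  · rintro a ⟨b, hab⟩
    rcases hab with ⟨hab, -⟩ | ⟨hxy, hab⟩
    · exact Or.inl ((hT i).2.1.1 ⟨_, hab⟩)
    · have := hxyW i hxy
      simp only [star_adj, Set.mem_insert_iff, Set.mem_singleton_iff] at hab
      simp only [Set.mem_union, Set.mem_ofPred_eq]
      grind
  · have key : ∀ a ∈ W i ∪ {u | u = v ∧ (T i).Adj x y}, ∃ b ∈ W i, (R i).Reachable a b := by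
      rintro a (ha | ⟨rfl, hxy⟩)
      · exact ⟨a, ha, Reachable.refl _⟩
      · exact ⟨x, (hxyW i hxy).1, (hvR i hxy).1.reachable⟩
    intro a ha b hb
    obtain ⟨a', ha', haa⟩ := key a ha
    obtain ⟨b', hb', hbb⟩ := key b hb
    exact haa.trans ((hreach i _ _ ((hT i).2.1.2 a' ha' b' hb')).trans hbb.symm)
  · exact (hT i).2.2.trans Set.subset_union_left
  · intro i j hij
    have hdij := hd i j hij
    refine ⟨?_, ?_⟩
    · intro a b hab hab'
      rw [hR] at hab hab'
      rcases hab with hab | hab <;> rcases hab' with hab' | hab'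
      · exact hdij.1 _ _ hab.1 hab'.1
      · have := hadj i a b hab.1
        simp only [star_adj] at hab'
        tauto
      · have := hadj j a b hab'.1
        simp only [star_adj] at hab
        tauto
      · exact hdij.1 _ _ hab.1 hab'.1
    · rintro a ⟨ha | ⟨rfl, ha⟩, hb | ⟨hav, hb⟩⟩
      · exact hdij.2 ⟨ha, hb⟩
      · exact (hvW i (hav ▸ ha)).elim
      · exact (hvW j hb).elim
      · exact (hdij.1 _ _ ha hb).elim

/-! ### Counting edges -/

theorem exists_le_ncard_edgeSet_eq {G : SimpleGraph V} {m : ℕ} (hm : m ≤ G.edgeSet.ncard) :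
    ∃ H ≤ G, H.edgeSet.ncard = m := by
  obtain ⟨t, ht, htm⟩ := Set.exists_subset_card_eq hm
  refine ⟨fromEdgeSet t, ?_, ?_⟩
  · rw [← fromEdgeSet_edgeSet G]
    exact fromEdgeSet_mono ht
  · rw [edgeSet_fromEdgeSet, sdiff_eq_left.2, htm]
    exact Set.disjoint_left.2 fun e he hd => G.not_isDiag_of_mem_edgeSet (ht he) hd

/-- The graph on all of `V` whose edges are those of `G` with both ends in `A`. -/
def within (G : SimpleGraph V) (A : Set V) : SimpleGraph V where
  Adj u w := G.Adj u w ∧ u ∈ A ∧ w ∈ A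
  symm := ⟨fun _ _ h => ⟨h.1.symm, h.2.2, h.2.1⟩⟩
  loopless := ⟨fun _ h => h.1.ne rfl⟩

theorem within_le (G : SimpleGraph V) (A : Set V) : within G A ≤ G := fun _ _ h => h.1

theorem support_within_subset (G : SimpleGraph V) (A : Set V) : (within G A).support ⊆ A :=
  fun _ ⟨_, h⟩ => h.2.1

section Counting

variable [Fintype V]

open Classical in
theorem ncard_edgeSet_eq (G : SimpleGraph V) : G.edgeSet.ncard = G.edgeFinset.card :=
  Set.ncard_eq_toFinset_card' _

open Classical in
theorem sum_degree_eq_of_support_subset {G : SimpleGraph V} {A : Finset V} (hA : G.support ⊆ A) :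
    ∑ v ∈ A, G.degree v = 2 * G.edgeSet.ncard := by
  rw [ncard_edgeSet_eq, ← sum_degrees_eq_twice_card_edges]
  refine Finset.sum_subset (Finset.subset_univ A) fun v _ hv => ?_
  by_contra h0
  exact hv (hA ((G.degree_pos_iff_mem_support v).1 (Nat.pos_of_ne_zero h0)))

open Classical in
theorem exists_degree_le_three {G : SimpleGraph V} {A : Finset V} (hA : G.support ⊆ A)
    (he : G.edgeSet.ncard + 2 ≤ 2 * A.card) : ∃ v ∈ A, G.degree v ≤ 3 := by
  by_contra! h
  have h1 : ∑ _v ∈ A, 4 ≤ ∑ v ∈ A, G.degree v := Finset.sum_le_sum fun v hv => h v hv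
  rw [sum_degree_eq_of_support_subset hA, Finset.sum_const, smul_eq_mul] at h1
  omega

theorem two_mul_ncard_edgeSet_le {G : SimpleGraph V} {A : Finset V} (hA : G.support ⊆ A) :
    2 * G.edgeSet.ncard ≤ A.card * (A.card - 1) := by
  classical
  rw [← sum_degree_eq_of_support_subset hA]
  refine (Finset.sum_le_card_nsmul _ _ (A.card - 1) fun v hv => ?_).trans_eq (smul_eq_mul _ _)
  rw [← Finset.card_erase_of_mem hv, ← card_neighborFinset_eq_degree]
  refine Finset.card_le_card fun w hw => ?_
  rw [mem_neighborFinset] at hw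
  exact Finset.mem_erase.2 ⟨hw.ne', hA ⟨_, hw.symm⟩⟩

theorem ncard_edgeSet_sup_edge {G : SimpleGraph V} {x y : V} (hxy : x ≠ y) (h : ¬ G.Adj x y) :
    (G ⊔ edge x y).edgeSet.ncard = G.edgeSet.ncard + 1 := by
  classical
  rw [ncard_edgeSet_eq, ncard_edgeSet_eq]
  convert card_edgeFinset_sup_edge G h hxy

/-- Four vertices span at most six edges, and six only if they form a clique. -/
theorem isNClique_four_of_ncard {G : SimpleGraph V} {A : Finset V} (hA : G.support ⊆ A)
    (h4 : A.card = 4) (he : 6 ≤ G.edgeSet.ncard) : G.IsNClique 4 A := by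
  refine ⟨fun x hx y hy hxy => ?_, h4⟩
  by_contra h
  have hs : (G ⊔ edge x y).support ⊆ A := by
    rintro a ⟨b, hab | hab⟩
    · exact hA ⟨b, hab⟩
    · rw [edge_adj] at hab
      rcases hab.1 with ⟨rfl, -⟩ | ⟨rfl, -⟩ <;> assumption
  have := two_mul_ncard_edgeSet_le hs
  rw [ncard_edgeSet_sup_edge hxy h, h4] at this
  omega

open Classical in
theorem ncard_edgeSet_deleteIncidenceSet (G : SimpleGraph V) (v : V) :
    (G.deleteIncidenceSet v).edgeSet.ncard + G.degree v = G.edgeSet.ncard := by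
  have h : (G.incidenceSet v).ncard = G.degree v := by
    rw [← card_incidenceFinset_eq_degree, ← Set.ncard_coe_finset, coe_incidenceFinset]
  rw [edgeSet_deleteIncidenceSet, ← h]
  exact Set.ncard_sdiff_add_ncard_of_subset (G.incidenceSet_subset v)

theorem ncard_edgeSet_le_add {G : SimpleGraph V} {A B : Set V}
    (h : ∀ u w, G.Adj u w → (u ∈ A ∧ w ∈ A) ∨ (u ∈ B ∧ w ∈ B)) :
    G.edgeSet.ncard ≤ (within G A).edgeSet.ncard + (within G B).edgeSet.ncard := by
  refine (Set.ncard_le_ncard ?_).trans (Set.ncard_union_le _ _)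
  intro e he
  induction e with
  | h u w =>
    rw [mem_edgeSet] at he
    exact (h u w he).imp (fun h => ⟨he, h⟩) fun h => ⟨he, h⟩

end Counting

/-! ### Graphs containing a `K₄` -/

/-- The vertices reachable from `c` in `H` are spanned by the edges of `H` among them. -/
theorem spans_within_reachable (H : SimpleGraph V) (c : V) :
    Spans (within H {u | H.Reachable c u}) {u | H.Reachable c u} := by
  have key : ∀ a, H.Reachable c a → (within H {u | H.Reachable c u}).Reachable c a := by
    intro a ha
    rw [reachable_iff_reflTransGen] at ha
    induction ha with
    | refl => rfl
    | tail h1 h2 ih =>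
      have h1' := (reachable_iff_reflTransGen _ _).2 h1
      exact ih.trans (Adj.reachable ⟨h2, h1', h1'.trans h2.reachable⟩)
  exact ⟨support_within_subset _ _, fun a ha b hb => (key a ha).symm.trans (key b hb)⟩

theorem exists_others_of_isNClique_four {G : SimpleGraph V} {K : Finset V} (hK : G.IsNClique 4 K)
    {x : V} (hx : x ∈ K) : ∃ a b c, G.Adj x a ∧ G.Adj x b ∧ G.Adj x c ∧ G.Adj a b ∧ G.Adj a c ∧
      G.Adj b c ∧ ∀ u, u ∈ K ↔ u = x ∨ u = a ∨ u = b ∨ u = c := by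
  classical
  have h3 : (K.erase x).card = 3 := by rw [Finset.card_erase_of_mem hx, hK.2]
  obtain ⟨a, b, c, hab, hac, hbc, h⟩ := Finset.card_eq_three.1 h3
  have hK' : ∀ u, u ∈ K ↔ u = x ∨ u = a ∨ u = b ∨ u = c := fun u => by
    rw [← Finset.insert_erase hx, h]
    simp only [Finset.mem_insert, Finset.mem_singleton]
  have hm : ∀ u ∈ ({a, b, c} : Finset V), u ∈ K ∧ x ≠ u := fun u hu =>
    have := Finset.mem_erase.1 (h ▸ hu)
    ⟨this.2, this.1.symm⟩
  have ha := hm a (by simp)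
  have hb := hm b (by simp)
  have hc := hm c (by simp)
  exact ⟨a, b, c, hK.1 hx ha.1 ha.2, hK.1 hx hb.1 hb.2, hK.1 hx hc.1 hc.2,
    hK.1 ha.1 hb.1 hab, hK.1 ha.1 hc.1 hac, hK.1 hb.1 hc.1 hbc, hK'⟩

theorem hasThree_of_two_isNClique {G : SimpleGraph V} {K L : Finset V} (hK : G.IsNClique 4 K)
    (hL : G.IsNClique 4 L) {x : V} (hx : ∀ u, u ∈ K ∧ u ∈ L ↔ u = x) : HasThree G := by
  obtain ⟨a, b, c, hxa, hxb, hxc, hab, hac, hbc, hKe⟩ :=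
    exists_others_of_isNClique_four hK ((hx x).2 rfl).1
  obtain ⟨p, q, r, hxp, hxq, hxr, hpq, hpr, hqr, hLe⟩ :=
    exists_others_of_isNClique_four hL ((hx x).2 rfl).2
  refine hasThree_of_two_cliques hxa hxb hxc hab hac hbc.ne hxp hxq hxr hpq hpr hqr.ne ?_
  intro u hu hu'
  have hux : u = x := by
    rw [← hx u, hKe, hLe]
    exact ⟨Or.inr hu, Or.inr hu'⟩
  have := hxa.ne
  have := hxb.ne
  have := hxc.ne
  grind

/-- If two vertices of a `K₄` are attached to the same component outside the `K₄`, there are three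
internally disjoint trees. -/
theorem hasThree_of_isNClique_of_reachable {G : SimpleGraph V} {K : Finset V}
    (hK : G.IsNClique 4 K) {c x y a b : V} (hc : c ∉ K) (hx : x ∈ K) (hy : y ∈ K) (hxy : x ≠ y)
    (hxa : G.Adj x a) (hyb : G.Adj y b) (hca : (within G (↑K)ᶜ).Reachable c a)
    (hcb : (within G (↑K)ᶜ).Reachable c b) : HasThree G := by
  have hout : ∀ u, (within G (↑K)ᶜ).Reachable c u → u ∉ K := by
    intro u hu
    by_cases h : u = c
    · rwa [h]
    · obtain ⟨w, hw⟩ := exists_adj_of_reachable_of_ne hu.symm h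
      exact fun huK => hw.2.1 (Finset.mem_coe.2 huK)
  obtain ⟨p, q, r, hxp, hxq, hxr, hpq, hpr, hqr, hKe⟩ := exists_others_of_isNClique_four hK hx
  have hp : p ∈ K := by simp [hKe]
  have hq : q ∈ K := by simp [hKe]
  have hr : r ∈ K := by simp [hKe]
  have hle := (within_le (within G (↑K)ᶜ) {u | (within G (↑K)ᶜ).Reachable c u}).trans
    (within_le _ _)
  have hs := spans_within_reachable (within G (↑K)ᶜ) c
  have hn : ∀ u ∈ K, u ∉ {u | (within G (↑K)ᶜ).Reachable c u} := fun u hu h => hout u h hu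
  rw [hKe] at hy
  rcases hy with rfl | rfl | rfl | rfl
  · exact (hxy rfl).elim
  · exact hasThree_of_clique_of_attached hxp hxq hxr hpq hpr hqr hle hs (hn _ hx) (hn _ hp)
      (hn _ hq) (hn _ hr) hca hcb hxa hyb
  · exact hasThree_of_clique_of_attached hxq hxp hxr hpq.symm hqr hpr hle hs (hn _ hx) (hn _ hq)
      (hn _ hp) (hn _ hr) hca hcb hxa hyb
  · exact hasThree_of_clique_of_attached hxr hxp hxq hpr.symm hqr.symm hpq hle hs (hn _ hx)
      (hn _ hr) (hn _ hp) (hn _ hq) hca hcb hxa hyb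

/-- The induction step for a graph containing a `K₄`. A component outside the `K₄` may be assumed
to be attached to at most one vertex `x` of it, so that `x` separates the graph into two parts,
one of which has again at least `2 k - 2` edges, where `k` is its number of vertices. -/
theorem hasThree_of_isNClique_of_smaller [Fintype V] {G : SimpleGraph V} {A K : Finset V}
    (hA : G.support ⊆ A) (h5 : 5 ≤ A.card) (he : 2 * A.card ≤ G.edgeSet.ncard + 2)
    (hK : G.IsNClique 4 K)
    (ih : ∀ (B : Finset V) (H : SimpleGraph V), B.card < A.card → H.support ⊆ B → 2 ≤ B.card →
      2 * B.card ≤ H.edgeSet.ncard + 2 → HasThree H ∨ H.IsNClique 4 B) : HasThree G := by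
  classical
  by_contra hG
  have hKA : K ⊆ A := by
    intro x hx
    obtain ⟨a, -, -, hxa, -⟩ := exists_others_of_isNClique_four hK hx
    exact hA ⟨a, hxa⟩
  obtain ⟨c, hcA, hcK⟩ := Finset.exists_mem_notMem_of_card_lt_card (by rw [hK.2]; omega :
    K.card < A.card)
  set H := within G (↑K)ᶜ with hH
  -- Every edge between the component of `c` and the clique ends in the same vertex `x`.
  obtain ⟨x, hxK, hx⟩ : ∃ x ∈ K, ∀ y ∈ K, ∀ u, H.Reachable c u → G.Adj y u → y = x := by
    by_cases hex : ∃ x ∈ K, ∃ a, H.Reachable c a ∧ G.Adj x a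
    · obtain ⟨x, hxK, a, hca, hxa⟩ := hex
      refine ⟨x, hxK, fun y hy b hcb hyb => ?_⟩
      by_contra hyx
      exact hG (hasThree_of_isNClique_of_reachable hK hcK hxK hy (Ne.symm hyx) hxa hyb hca hcb)
    · push Not at hex
      obtain ⟨x, hxK⟩ : K.Nonempty := Finset.card_pos.1 (by rw [hK.2]; omega)
      exact ⟨x, hxK, fun y hy u hu hyu => (hex y hy u hu hyu).elim⟩
  set C := A.filter (H.Reachable c) with hC
  have hmemC : ∀ u, u ∈ C ↔ u ∈ A ∧ H.Reachable c u := fun u => by simp [hC]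
  have hCK : ∀ u ∈ C, u ∉ K := by
    intro u hu
    by_cases h : u = c
    · rwa [h]
    · obtain ⟨w, hw⟩ := exists_adj_of_reachable_of_ne ((hmemC u).1 hu).2.symm h
      exact fun huK => hw.2.1 (Finset.mem_coe.2 huK)
  have hcC : c ∈ C := (hmemC c).2 ⟨hcA, Reachable.refl _⟩
  have hxC : x ∉ C := fun h => hCK x h hxK
  have hstep : ∀ u w, G.Adj u w → u ∈ C → w ∈ insert x C := by
    intro u w huw hu
    rw [Finset.mem_insert]
    by_cases hw : w ∈ K
    · exact Or.inl (hx w hw u ((hmemC u).1 hu).2 huw.symm)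
    · refine Or.inr ((hmemC w).2 ⟨hA ⟨u, huw.symm⟩, ((hmemC u).1 hu).2.trans (Adj.reachable ?_)⟩)
      exact ⟨huw, hCK u hu, hw⟩
  have hsum := ncard_edgeSet_le_add (G := G) (A := ↑(insert x C)) (B := ↑(A \ C)) (by
    intro u w huw
    simp only [Finset.mem_coe]
    by_cases hu : u ∈ C
    · exact Or.inl ⟨Finset.mem_insert_of_mem hu, hstep u w huw hu⟩
    · by_cases hw : w ∈ C
      · exact Or.inl ⟨hstep w u huw.symm hw, Finset.mem_insert_of_mem hw⟩
      · exact Or.inr ⟨Finset.mem_sdiff.2 ⟨hA ⟨w, huw⟩, hu⟩,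
          Finset.mem_sdiff.2 ⟨hA ⟨u, huw.symm⟩, hw⟩⟩)
  have hCA : C ⊆ A := Finset.filter_subset _ _
  have hKC : K ⊆ A \ C := fun u hu => Finset.mem_sdiff.2 ⟨hKA hu, fun h => hCK u h hu⟩
  have h4 : 4 ≤ (A \ C).card := hK.2 ▸ Finset.card_le_card hKC
  have hCpos : 0 < C.card := Finset.card_pos.2 ⟨c, hcC⟩
  have hcard : (A \ C).card + C.card = A.card := Finset.card_sdiff_add_card_eq_card hCA
  have hins : (insert x C).card = C.card + 1 := Finset.card_insert_of_notMem hxC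
  by_cases hcase : 2 * (insert x C).card ≤ (within G ↑(insert x C)).edgeSet.ncard + 2
  · rcases ih _ _ (by omega) (support_within_subset G ↑(insert x C)) (by omega) hcase with h | h
    · exact hG (h.mono (within_le _ _))
    · refine hG (hasThree_of_two_isNClique hK (h.mono (within_le _ _)) (x := x) fun u => ?_)
      rw [Finset.mem_insert]
      constructor
      · rintro ⟨hu, rfl | hu'⟩
        exacts [rfl, (hCK u hu' hu).elim]
      · rintro rfl
        exact ⟨hxK, Or.inl rfl⟩
  · rcases ih _ _ (by omega) (support_within_subset G ↑(A \ C)) (by omega) (by omega) with h | h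
    · exact hG (h.mono (within_le _ _))
    · have := two_mul_ncard_edgeSet_le (support_within_subset G ↑(A \ C))
      rw [h.2] at this
      have := h.2
      omega

/-! ### The extremal bound -/

/-- A graph with `k ≥ 2` vertices and at least `2 k - 2` edges contains three internally disjoint
trees, or is a `K₄`. The vertex set is a finite subset `A` of a fixed type, so that the smaller
graphs of the induction live on the same type. -/
theorem hasThree_or_isNClique_four [Fintype V] (A : Finset V) (G : SimpleGraph V)
    (hA : G.support ⊆ A) (h2 : 2 ≤ A.card) (he : 2 * A.card ≤ G.edgeSet.ncard + 2) :
    HasThree G ∨ G.IsNClique 4 A := by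
  classical
  induction hn : A.card using Nat.strong_induction_on generalizing A G with
  | _ n ih =>
  subst hn
  have ih' : ∀ (B : Finset V) (H : SimpleGraph V), B.card < A.card → H.support ⊆ B →
      2 ≤ B.card → 2 * B.card ≤ H.edgeSet.ncard + 2 → HasThree H ∨ H.IsNClique 4 B :=
    fun B H hB hH h2 he => ih B.card hB B H hH h2 he rfl
  clear ih
  have hle := two_mul_ncard_edgeSet_le hA
  by_cases h5 : A.card < 5
  · interval_cases h : A.card
    · omega
    · omega
    · exact Or.inr (isNClique_four_of_ncard hA h (by omega))
  refine Or.inl ?_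
  rw [not_lt] at h5
  obtain ⟨G', hG', he'⟩ := exists_le_ncard_edgeSet_eq (G := G) (m := 2 * A.card - 2) (by omega)
  refine HasThree.mono hG' ?_
  replace hA : G'.support ⊆ A := fun u ⟨w, hw⟩ => hA ⟨w, hG' hw⟩
  clear he hle hG'
  obtain ⟨v, hvA, hv⟩ := exists_degree_le_three hA (by omega)
  have hB : (A.erase v).card = A.card - 1 := Finset.card_erase_of_mem hvA
  have hdel := ncard_edgeSet_deleteIncidenceSet G' v
  have hsupp : (G'.deleteIncidenceSet v).support ⊆ ↑(A.erase v) := by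
    rintro u ⟨w, hw⟩
    replace hw := deleteIncidenceSet_adj.1 hw
    exact Finset.mem_coe.2 (Finset.mem_erase.2 ⟨hw.2.1, hA ⟨w, hw.1⟩⟩)
  by_cases hd : G'.degree v ≤ 2
  · rcases ih' (A.erase v) (G'.deleteIncidenceSet v) (by omega) hsupp (by omega) (by omega)
      with h | h
    · exact h.mono (G'.deleteIncidenceSet_le v)
    · exact hasThree_of_isNClique_of_smaller hA h5 (by omega)
        (h.mono (G'.deleteIncidenceSet_le v)) ih'
  have hd3 : G'.degree v = 3 := by omega
  by_cases hN : G'.IsClique (G'.neighborFinset v)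
  · refine hasThree_of_isNClique_of_smaller (K := insert v (G'.neighborFinset v)) hA h5
      (by omega) ?_ ih'
    exact IsNClique.insert ⟨hN, hd3⟩ fun b hb => (G'.mem_neighborFinset v b).1 hb
  -- Two neighbours `x, y` of `v` are not adjacent: delete `v` and join `x` and `y`.
  obtain ⟨x, hx, y, hy, hxy, hnxy⟩ : ∃ x ∈ G'.neighborFinset v, ∃ y ∈ G'.neighborFinset v,
      x ≠ y ∧ ¬ G'.Adj x y := by
    by_contra! h
    exact hN fun x hx y hy hxy => h x hx y hy hxy
  have hvx := (G'.mem_neighborFinset v x).1 hx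
  have hvy := (G'.mem_neighborFinset v y).1 hy
  have hs : (G'.deleteIncidenceSet v ⊔ edge x y).support ⊆ ↑(A.erase v) := by
    rintro a ⟨b, hab | hab⟩
    · exact hsupp ⟨b, hab⟩
    · rw [edge_adj] at hab
      rw [Finset.mem_coe, Finset.mem_erase]
      rcases hab.1 with ⟨rfl, -⟩ | ⟨rfl, -⟩
      · exact ⟨hvx.ne', hA ⟨v, hvx.symm⟩⟩
      · exact ⟨hvy.ne', hA ⟨v, hvy.symm⟩⟩
  have hc := ncard_edgeSet_sup_edge (G := G'.deleteIncidenceSet v) hxy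
    fun h => hnxy (G'.deleteIncidenceSet_le v h)
  rcases ih' _ _ (by omega) hs (by omega) (by omega) with h | h
  · exact h.of_suppress hvx hvy
  -- Now `A` has five vertices: `v`, its neighbours `x, y, z`, and one more vertex `u`.
  obtain ⟨z, hz, hzx, hzy⟩ : ∃ z ∈ G'.neighborFinset v, z ≠ x ∧ z ≠ y := by
    obtain ⟨z, hz, hz'⟩ := Finset.exists_mem_notMem_of_card_lt_card
      (s := {x, y}) (t := G'.neighborFinset v) (by
        rw [Finset.card_pair hxy, card_neighborFinset_eq_degree]; omega)
    simp only [Finset.mem_insert, Finset.mem_singleton, not_or] at hz'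
    exact ⟨z, hz, hz'⟩
  have hvz := (G'.mem_neighborFinset v z).1 hz
  obtain ⟨u, hu, hu'⟩ := Finset.exists_mem_notMem_of_card_lt_card
      (s := {x, y, z}) (t := A.erase v) (by rw [h.2]; exact Finset.card_le_three.trans_lt (by omega))
  simp only [Finset.mem_insert, Finset.mem_singleton, not_or] at hu'
  have huv := (Finset.mem_erase.1 hu).1
  have hmem : ∀ w, G'.Adj v w → w ∈ A.erase v := fun w hw =>
    Finset.mem_erase.2 ⟨hw.ne', hA ⟨v, hw.symm⟩⟩
  have hadj : ∀ a ∈ A.erase v, ∀ b ∈ A.erase v, a ≠ b → ¬ (a = x ∧ b = y ∨ a = y ∧ b = x) →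
      G'.Adj a b := by
    intro a ha b hb hab hne
    rcases h.1 ha hb hab with h' | h'
    · exact G'.deleteIncidenceSet_le v h'
    · rw [edge_adj] at h'
      exact (hne h'.1).elim
  have hx' := hmem x hvx
  have hy' := hmem y hvy
  have hz' := hmem z hvz
  exact hasThree_of_two_stars (hadj u hu x hx' hu'.1 (by tauto)) (hadj u hu y hy' hu'.2.1 (by tauto))
    (hadj u hu z hz' hu'.2.2 (by tauto)) hvx hvy hvz (hadj x hx' z hz' hzx.symm (by tauto))
    (hadj y hy' z hz' hzy.symm (by tauto)) hxy huv

/-! ### Passing to generalized local connectivity -/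

theorem le_localConn [Finite V] {G : SimpleGraph V} {S : Set V} {F : Finset G.Subgraph}
    (hF : IsSteinerPacking G S F) : F.card ≤ localConn G S :=
  (localConn_isGreatest G S).2 ⟨F, hF, rfl⟩

/-- A connected graph with edges `T ≤ G` and vertex set `W` contains a tree of `G` on `W`. -/
theorem Spans.exists_isTree {G T : SimpleGraph V} {W : Set V} (hT : T ≤ G) (h : Spans T W)
    (hne : W.Nonempty) : ∃ K : G.Subgraph, K.verts = W ∧ K.coe.IsTree ∧
      ∀ a b, K.Adj a b → T.Adj a b := by
  let H : G.Subgraph :=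
    { verts := W
      Adj := T.Adj
      adj_sub := fun h => hT h
      edge_vert := fun hab => h.1 ⟨_, hab⟩
      symm := T.symm }
  have hlift : ∀ a b (ha : a ∈ W) (hb : b ∈ W), T.Reachable a b →
      H.coe.Reachable ⟨a, ha⟩ ⟨b, hb⟩ := by
    rintro a b ha hb ⟨p⟩
    induction p with
    | nil => rfl
    | cons hab _ ih =>
      exact (Adj.reachable (G := H.coe) (u := ⟨_, ha⟩) (v := ⟨_, h.1 ⟨_, hab.symm⟩⟩) hab).trans
        (ih _ hb)
  have hconn : H.coe.Connected :=
    { preconnected := fun a b => hlift _ _ a.2 b.2 (h.2 _ a.2 _ b.2)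
      nonempty := hne.to_subtype }
  obtain ⟨U, hU, hUt⟩ := hconn.exists_isTree_le
  let K : G.Subgraph :=
    { verts := W
      Adj := fun a b => ∃ (ha : a ∈ W) (hb : b ∈ W), U.Adj ⟨a, ha⟩ ⟨b, hb⟩
      adj_sub := fun ⟨_, _, hab⟩ => hT (hU hab)
      edge_vert := fun ⟨ha, _, _⟩ => ha
      symm := ⟨fun _ _ ⟨ha, hb, hab⟩ => ⟨hb, ha, hab.symm⟩⟩ }
  have hKU : K.coe = U := by
    ext a b
    exact ⟨fun ⟨_, _, hab⟩ => hab, fun hab => ⟨a.2, b.2, hab⟩⟩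
  exact ⟨K, rfl, hKU ▸ hUt, fun a b ⟨_, _, hab⟩ => hU hab⟩

/-- Each vertex of `S` has a neighbour in every `S`-tree. -/
theorem IsSteinerTree.exists_adj {G : SimpleGraph V} {S : Finset V} (hS : S.card = 3)
    {T : G.Subgraph} (hT : IsSteinerTree G S T) {v : V} (hv : v ∈ S) : ∃ w, T.Adj v w := by
  obtain ⟨s, hs, hsv⟩ := Finset.exists_mem_ne (by omega : 1 < S.card) v
  obtain ⟨w, hw⟩ := exists_adj_of_reachable_of_ne
    (hT.2.1.preconnected ⟨v, hT.1 hv⟩ ⟨s, hT.1 hs⟩) (by simpa using hsv.symm)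
  exact ⟨w, hw⟩

theorem InternallyDisjoint.not_adj {G : SimpleGraph V} {S : Set V} {T T' : G.Subgraph}
    (h : InternallyDisjoint S T T') {a b : V} (hab : T.Adj a b) : ¬ T'.Adj a b := fun hab' => by
  have : s(a, b) ∈ T.edgeSet ∩ T'.edgeSet := ⟨hab, hab'⟩
  rw [h.1] at this
  exact this

theorem HasThree.three_le_maxLocalConn [Fintype V] {G : SimpleGraph V} (hG : HasThree G) :
    3 ≤ maxLocalConn 3 G := by
  classical
  obtain ⟨S, T, W, hS, hT, hd⟩ := hG
  obtain ⟨s, hs⟩ : S.Nonempty := Finset.card_pos.1 (by omega)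
  choose K hKW hKt hKT using fun i => (hT i).2.1.exists_isTree (hT i).1 ⟨s, (hT i).2.2 hs⟩
  have hst : ∀ i, IsSteinerTree G S (K i) := fun i => ⟨(hKW i).symm ▸ (hT i).2.2, hKt i⟩
  have hdis : ∀ i j, i ≠ j → InternallyDisjoint S (K i) (K j) := by
    intro i j hij
    refine ⟨Set.eq_empty_iff_forall_notMem.2 fun e => ?_, ?_⟩
    · induction e with
      | h a b => exact fun ⟨h, h'⟩ => (hd i j hij).1 a b (hKT i _ _ h) (hKT j _ _ h')
    · rw [hKW, hKW]
      exact (hd i j hij).2.antisymm (Set.subset_inter (hT i).2.2 (hT j).2.2)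
  have hinj : Function.Injective K := by
    intro i j hij
    by_contra hne
    obtain ⟨w, hw⟩ := (hst i).exists_adj hS hs
    exact (hdis i j hne).not_adj hw (hij ▸ hw)
  have hF : IsSteinerPacking G S (Finset.univ.image K) := by
    refine ⟨?_, ?_⟩
    · simp only [Finset.mem_image, Finset.mem_univ, true_and]
      rintro _ ⟨i, rfl⟩
      exact hst i
    · simp only [Finset.mem_image, Finset.mem_univ, true_and]
      rintro _ ⟨i, rfl⟩ _ ⟨j, rfl⟩ hne
      exact hdis i j fun h => hne (h ▸ rfl)
  have h3 : 3 ≤ localConn G (S : Set V) := by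
    refine le_trans (le_of_eq ?_) (le_localConn hF)
    rw [Finset.card_image_of_injective _ hinj, Finset.card_univ, Fintype.card_fin]
  exact h3.trans (Finset.le_sup (f := fun S : Finset V => localConn G (S : Set V))
    (Finset.mem_powersetCard.2 ⟨Finset.subset_univ S, hS⟩))

theorem exists_packing_of_three_le_maxLocalConn [Fintype V] {G : SimpleGraph V}
    (hG : 3 ≤ maxLocalConn 3 G) : ∃ (S : Finset V) (F : Finset G.Subgraph), S.card = 3 ∧
      IsSteinerPacking G S F ∧ 3 ≤ F.card := by
  obtain ⟨S, hS, h3⟩ := (Finset.le_sup_iff (by simp)).1 hG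
  obtain ⟨F, hF, hc⟩ := (localConn_isGreatest G (S : Set V)).1
  exact ⟨S, F, (Finset.mem_powersetCard.1 hS).2, hF, hc ▸ h3⟩

/-! ### Graphs without three internally disjoint trees -/

/-- Internally disjoint `S`-trees use different edges at a vertex of `S`. -/
theorem IsSteinerPacking.card_le_ncard_neighborSet [Finite V] {G : SimpleGraph V} {S : Finset V}
    {F : Finset G.Subgraph} (hS : S.card = 3) (hF : IsSteinerPacking G S F) {v : V} (hv : v ∈ S) :
    F.card ≤ (G.neighborSet v).ncard := by
  have h : ∀ T : F, ∃ w, T.1.Adj v w := fun T => (hF.1 T T.2).exists_adj hS hv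
  choose f hf using h
  rw [← Nat.card_coe_set_eq, ← Fintype.card_coe, ← Nat.card_eq_fintype_card]
  refine Nat.card_le_card_of_injective (fun T => ⟨f T, (hf T).adj_sub⟩) fun T T' hTT => ?_
  have hff : f T = f T' := congrArg Subtype.val hTT
  by_contra hne
  exact (hF.2 T T.2 T' T'.2 fun h => hne (Subtype.ext h)).not_adj (hf T) (hff ▸ hf T')

/-- The join of an edge and an edgeless graph: the vertices `0` and `1` are adjacent to each other
and to all other vertices. -/
def hubGraph (n : ℕ) : SimpleGraph (Fin n) where
  Adj i j := i ≠ j ∧ (i.val < 2 ∨ j.val < 2)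
  symm := ⟨fun _ _ h => ⟨h.1.symm, h.2.symm⟩⟩
  loopless := ⟨fun _ h => h.1 rfl⟩

/-- A triple contains a vertex other than the two hubs, and this vertex has degree at most `2`. -/
theorem maxLocalConn_lt_of_le_hubGraph {n : ℕ} {G : SimpleGraph (Fin n)} (hG : G ≤ hubGraph n) :
    ¬ 3 ≤ maxLocalConn 3 G := by
  intro h3
  obtain ⟨S, F, hS, hF, hFc⟩ := exists_packing_of_three_le_maxLocalConn h3
  have hsmall : (Finset.univ.filter fun i : Fin n => i.val < 2).card ≤ 2 := by
    rw [← Finset.card_map Fin.valEmbedding, ← Finset.card_range 2]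
    refine Finset.card_le_card fun i hi => ?_
    simp only [Finset.mem_map, Finset.mem_filter] at hi
    obtain ⟨j, hj, rfl⟩ := hi
    exact Finset.mem_range.2 hj.2
  obtain ⟨v, hv, hv'⟩ := Finset.exists_mem_notMem_of_card_lt_card (hsmall.trans_lt (by omega) :
    _ < S.card)
  have hle := hF.card_le_ncard_neighborSet hS hv
  have hsub : G.neighborSet v ⊆ ↑(Finset.univ.filter fun i : Fin n => i.val < 2) := by
    intro w hw
    have := hG hw
    simp only [Finset.mem_filter, Finset.mem_univ, true_and] at hv'
    simpa using this.2.resolve_left hv'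
  have := Set.ncard_le_ncard hsub
  rw [Set.ncard_coe_finset] at this
  omega

theorem two_mul_sub_three_le_ncard_hubGraph {n : ℕ} (hn : 2 ≤ n) :
    2 * n - 3 ≤ (hubGraph n).edgeSet.ncard := by
  classical
  obtain ⟨k, rfl⟩ := Nat.exists_eq_add_of_le' hn
  have hdeg : ∀ i : Fin (k + 2), (if i.val < 2 then k + 1 else 2) ≤ (hubGraph (k + 2)).degree i := by
    intro i
    rw [← card_neighborFinset_eq_degree]
    split_ifs with hi
    · have h1 : (Finset.univ.erase i).card = k + 1 := by
        rw [Finset.card_erase_of_mem (Finset.mem_univ i), Finset.card_univ, Fintype.card_fin]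
        rfl
      rw [← h1]
      refine Finset.card_le_card fun j hj => ?_
      rw [mem_neighborFinset]
      exact ⟨(Finset.ne_of_mem_erase hj).symm, Or.inl hi⟩
    · refine (Finset.card_pair (zero_ne_one : (0 : Fin (k + 2)) ≠ 1)).ge.trans ?_
      refine Finset.card_le_card fun j hj => ?_
      have hj2 : j.val < 2 := by
        rcases Finset.mem_insert.1 hj with rfl | hj
        · simp
        · rw [Finset.mem_singleton.1 hj]
          simp
      rw [mem_neighborFinset]
      exact ⟨fun h => hi (h ▸ hj2), Or.inr hj2⟩
  have hsum := Finset.sum_le_sum fun i (_ : i ∈ Finset.univ) => hdeg i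
  rw [sum_degrees_eq_twice_card_edges, ← ncard_edgeSet_eq] at hsum
  simp [Fin.sum_univ_succ] at hsum
  omega

/-- A graph on four vertices does not contain three internally disjoint trees: at most one of them
contains the vertex outside `S`, and the triangle on `S` has no two edge-disjoint spanning
trees. -/
theorem maxLocalConn_lt_of_card_eq_four [Fintype V] (hV : Fintype.card V = 4) (G : SimpleGraph V) :
    ¬ 3 ≤ maxLocalConn 3 G := by
  classical
  intro h3
  obtain ⟨S, F, hS, hF, hFc⟩ := exists_packing_of_three_le_maxLocalConn h3
  obtain ⟨d, hd⟩ : ∃ d, Sᶜ = {d} := Finset.card_eq_one.1 (by rw [Finset.card_compl, hV, hS])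
  have hdS : ∀ u, u ∉ S → u = d := fun u hu => by
    rw [← Finset.mem_compl, hd] at hu
    exact Finset.mem_singleton.1 hu
  have hd' : d ∉ S := by
    rw [← Finset.mem_compl, hd]
    exact Finset.mem_singleton_self d
  have hone : (F.filter fun T => d ∈ T.verts).card ≤ 1 := by
    rw [Finset.card_le_one]
    intro T hT T' hT'
    rw [Finset.mem_filter] at hT hT'
    by_contra hne
    have hdv : d ∈ T.verts ∩ T'.verts := ⟨hT.2, hT'.2⟩
    rw [(hF.2 T hT.1 T' hT'.1 hne).2] at hdv
    exact hd' hdv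
  have htwo : 1 < (F.filter fun T => d ∉ T.verts).card := by
    have := Finset.card_filter_add_card_filter_not (s := F) (fun T => d ∈ T.verts)
    omega
  obtain ⟨T, hT, T', hT', hne⟩ := Finset.one_lt_card.1 htwo
  rw [Finset.mem_filter] at hT hT'
  obtain ⟨a, b, c, hab, hac, hbc, rfl⟩ := Finset.card_eq_three.1 hS
  have hadj : ∀ U ∈ F, d ∉ U.verts →
      (U.Adj a b ∨ U.Adj a c) ∧ (U.Adj a b ∨ U.Adj b c) ∧ (U.Adj a c ∨ U.Adj b c) := by
    intro U hU hdU
    have hnbr : ∀ v ∈ ({a, b, c} : Finset V), ∃ w, (w = a ∨ w = b ∨ w = c) ∧ U.Adj v w := by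
      intro v hv
      obtain ⟨w, hw⟩ := (hF.1 U hU).exists_adj hS hv
      refine ⟨w, ?_, hw⟩
      by_contra hwS
      exact hdU (hdS w (by simpa using hwS) ▸ U.edge_vert hw.symm)
    refine ⟨?_, ?_, ?_⟩
    · obtain ⟨w, rfl | rfl | rfl, h⟩ := hnbr a (by simp)
      exacts [(h.ne rfl).elim, Or.inl h, Or.inr h]
    · obtain ⟨w, rfl | rfl | rfl, h⟩ := hnbr b (by simp)
      exacts [Or.inl h.symm, (h.ne rfl).elim, Or.inr h]
    · obtain ⟨w, rfl | rfl | rfl, h⟩ := hnbr c (by simp)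
      exacts [Or.inl h.symm, Or.inr h.symm, (h.ne rfl).elim]
  -- Each of `T` and `T'` uses at least two of the three edges of the triangle.
  have hdis : ∀ u w, T.Adj u w → ¬ T'.Adj u w := fun u w =>
    (hF.2 T hT.1 T' hT'.1 hne).not_adj
  have h1 := hadj T hT.1 hT.2
  have h2 := hadj T' hT'.1 hT'.2
  have e1 := hdis a b
  have e2 := hdis a c
  have e3 := hdis b c
  clear * - h1 h2 e1 e2 e3
  tauto

end SteinerConn

theorem mainTheorem3 (n : ℕ) (hn : 3 ≤ n) :
    SteinerConn.h n 3 3 = if n = 4 then 2 * n - 1 else 2 * n - 2 := by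
  have hlow : ∀ m ∈ SteinerConn.forcingSizes n 3 3, 2 * n - 2 ≤ m := by
    intro m hm
    by_contra! hlt
    obtain ⟨G, hG, hGm⟩ := SteinerConn.exists_le_ncard_edgeSet_eq
      ((by omega : m ≤ 2 * n - 3).trans (SteinerConn.two_mul_sub_three_le_ncard_hubGraph (by omega)))
    exact SteinerConn.maxLocalConn_lt_of_le_hubGraph hG (hm G hGm)
  refine (SteinerConn.h_isLeast n 3 3).unique ?_
  split_ifs with h4
  · subst h4
    have hle : ∀ G : SimpleGraph (Fin 4), G.edgeSet.ncard ≤ 6 := fun G => by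
      have := SteinerConn.two_mul_ncard_edgeSet_le (G := G) (A := Finset.univ) (by simp)
      rw [Finset.card_univ, Fintype.card_fin] at this
      omega
    refine ⟨fun G hG => absurd (hle G) (by omega), fun m hm => ?_⟩
    by_contra! hlt
    -- Since `m ≤ 6`, some graph on four vertices has exactly `m` edges.
    have h6 : m ≤ (SteinerConn.hubGraph 4 ⊔ SimpleGraph.edge 2 3).edgeSet.ncard := by
      rw [SteinerConn.ncard_edgeSet_sup_edge (by decide : (2 : Fin 4) ≠ 3)
        fun h : (SteinerConn.hubGraph 4).Adj 2 3 => absurd h.2 (by decide)]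
      have := SteinerConn.two_mul_sub_three_le_ncard_hubGraph (n := 4) (by omega)
      omega
    obtain ⟨G, -, hGm⟩ := SteinerConn.exists_le_ncard_edgeSet_eq h6
    exact SteinerConn.maxLocalConn_lt_of_card_eq_four (Fintype.card_fin 4) G (hm G hGm)
  · refine ⟨fun G hG => ?_, hlow⟩
    rcases SteinerConn.hasThree_or_isNClique_four Finset.univ G (by simp)
      (by rw [Finset.card_univ, Fintype.card_fin]; omega)
      (by rw [Finset.card_univ, Fintype.card_fin]; omega) with h | h
    · exact h.three_le_maxLocalConn
    · have := h.2
      rw [Finset.card_univ, Fintype.card_fin] at this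
      exact (h4 this).elim
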